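/- Let $\mathcal A\subset B(H)$ be a von Neumann factor of type $II_1$ (a factor that is finite and has no minimal projections), with tracial state $\tau$, and let $2\le\rho<\infty$. Let $\mathcal P_{\mathcal A}$ be the set of (selfadjoint) projections of $\mathcal A$. For $x\in\mathcal A$ put $\|x\|_\rho=\tau\big((x^*x)^{\rho/2}\big)^{1/\rho}$, and for $p,q\in\mathcal P_{\mathcal A}$ let $$d_\rho(p,q)=\inf\Big\{\int_{a}^{b}\|\dot\gamma(t)\|_\rho\,dt\ :\ a<b,\ \gamma:[a,b]\to\mathcal P_{\mathcal A}\ \text{smooth},\ \gamma(a)=p,\ \gamma(b)=q\Big\}\in[0,\infty].$$ A geodesic of $\mathcal P_{\mathcal A}$ is a smooth curve $\delta:\mathbb R\to\mathcal P_{\mathcal A}$ with $\frac{D}{dt}\dot\delta=0$, where $\frac{D}{dt}X=\delta\dot X(1-\delta)+(1-\delta)\dot X\delta$ is the component of $\dot X$ that is co-diagonal (i.e. tangent) at $\delta(t)$; these are the curves $\delta(t)=e^{tz}pe^{-tz}$ with $p=\delta(0)$, $z^*=-z\in\mathcal A$ and $z=pz+zp$. It is called normalized if $\|\dot\delta(0)\|\le\pi/2$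 (operator norm), and it joins $p$ and $q$ if $\delta(0)=p$, $\delta(1)=q$. Then: 1. For every $\varepsilon>0$ there exist projections $p\ne q$ in $\mathcal P_{\mathcal A}$ with $d_\rho(p,q)<\varepsilon$ which are joined by infinitely many normalized geodesics. 2. Consequently there are no normal neighbourhoods for $d_\rho$: if $p\in\mathcal P_{\mathcal A}$ and $p\neq 0,1$, then there is no set $U\subset\mathcal P_{\mathcal A}$ which contains a $d_\rho$-ball around $p$ and is such that every $q\in U$ is joined to $p$ by exactly one normalized geodesic. -/

import Mathlib

open scoped ContDiff ENNReal

noncomputable section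

namespace ProjGeom

/-! ### Type II₁ factors -/

section VonNeumann

variable {H : Type*} [NormedAddCommGroup H] [InnerProductSpace ℂ H] [CompleteSpace H]

/-- The type of elements of a von Neumann algebra `A ⊆ B(H)`. -/
abbrev Elt (A : VonNeumannAlgebra H) : Type _ := A.toStarSubalgebra

/-- A von Neumann algebra is norm closed in `B(H)`; by this instance `Elt A` is a C⋆-algebra. -/
instance isClosed_carrier (A : VonNeumannAlgebra H) :
    IsClosed (A.toStarSubalgebra : Set (H →L[ℂ] H)) := by
  have h : (A.toStarSubalgebra : Set (H →L[ℂ] H))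
      = Set.centralizer (Set.centralizer (A.toStarSubalgebra : Set (H →L[ℂ] H))) :=
    A.centralizer_centralizer'.symm
  rw [h]
  exact Set.isClosed_centralizer _

/-- A factor: a nonzero von Neumann algebra whose center consists of the scalars. -/
structure IsFactor (A : VonNeumannAlgebra H) : Prop where
  one_ne_zero : (1 : Elt A) ≠ 0
  center_trivial : ∀ x : Elt A, (∀ y : Elt A, x * y = y * x) → ∃ c : ℂ, x = c • (1 : Elt A)

/-- A factor of type II₁: a factor which is finite (the identity is not Murray-von Neumann
equivalent to a proper subprojection) and has no minimal projections
(every nonzero projection has a nonzero proper subprojection). -/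
structure IsTypeIIOneFactor (A : VonNeumannAlgebra H) : Prop extends IsFactor A where
  finite : ∀ v : Elt A, star v * v = 1 → v * star v = 1
  no_minimal : ∀ p : Elt A, IsStarProjection p → p ≠ 0 →
    ∃ q : Elt A, IsStarProjection q ∧ p * q = q ∧ q ≠ 0 ∧ q ≠ p

end VonNeumann

section Geometry

variable {M : Type*} [CStarAlgebra M]

/-! ### The trace and its `ρ`-norms -/

/-- A tracial state. On a type II₁ factor there is exactly one, and it is automatically
faithful and normal. -/
structure IsTracialState (τ : M →ₗ[ℂ] ℂ) : Prop where
  map_one : τ 1 = 1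
  nonneg_re : ∀ x : M, 0 ≤ (τ (star x * x)).re
  im_eq_zero : ∀ x : M, (τ (star x * x)).im = 0
  tracial : ∀ x y : M, τ (x * y) = τ (y * x)

/-- `‖x‖_ρ = τ((x⋆x)^{ρ/2})^{1/ρ}`, the power being taken by continuous functional calculus. -/
def rhoNorm (τ : M →ₗ[ℂ] ℂ) (ρ : ℝ) (x : M) : ℝ :=
  (τ (cfc (fun t : ℝ => t ^ (ρ / 2)) (star x * x))).re ^ (1 / ρ)

/-! ### Curves of projections, length and distance -/

/-- `γ` restricted to `[a, b]` is a smooth curve of projections which joins `p` and `q`. -/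
structure IsSmoothCurveJoining (γ : ℝ → M) (a b : ℝ) (p q : M) : Prop where
  lt : a < b
  smooth : ContDiffOn ℝ ∞ γ (Set.Icc a b)
  proj : ∀ t ∈ Set.Icc a b, IsStarProjection (γ t)
  left : γ a = p
  right : γ b = q

/-- The length `∫_a^b ‖γ'(t)‖_ρ dt` of a curve on `[a, b]`. -/
def rhoLength (τ : M →ₗ[ℂ] ℂ) (ρ : ℝ) (γ : ℝ → M) (a b : ℝ) : ℝ≥0∞ :=
  ∫⁻ t in Set.Icc a b, ENNReal.ofReal (rhoNorm τ ρ (derivWithin γ (Set.Icc a b) t))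

/-- `d_ρ(p, q)`: the infimum of the `ρ`-lengths of the smooth curves of projections joining
`p` and `q` (it is `∞` if there is no such curve). -/
def rhoDist (τ : M →ₗ[ℂ] ℂ) (ρ : ℝ) (p q : M) : ℝ≥0∞ :=
  ⨅ (γ : ℝ → M) (a : ℝ) (b : ℝ) (_ : IsSmoothCurveJoining γ a b p q), rhoLength τ ρ γ a b

/-! ### Geodesics -/

/-- The co-diagonal part `p x (1 - p) + (1 - p) x p` of `x` with respect to the projection `p`.
On selfadjoint elements it is the projection onto the tangent space at `p` of the manifold
of projections. -/
def codiag (p x : M) : M := p * x * (1 - p) + (1 - p) * x * p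

/-- A geodesic of the manifold of projections: a smooth curve of projections whose velocity is
parallel for the natural linear connection, whose covariant derivative `DX/dt` is the tangential
(co-diagonal) part of `X'` with respect to `δ(t)`. These are the curves
`δ(t) = e^{tz} p e^{-tz}` with `z⋆ = -z` co-diagonal with respect to `p = δ(0)`. -/
structure IsGeodesic (δ : ℝ → M) : Prop where
  smooth : ContDiff ℝ ∞ δ
  proj : ∀ t, IsStarProjection (δ t)
  parallel : ∀ t, codiag (δ t) (deriv (deriv δ) t) = 0

/-- `δ` is a normalized geodesic (its initial velocity has C⋆-norm at most `π / 2`) with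
`δ(0) = p` and `δ(1) = q`. -/
structure IsNormalizedGeodesicJoining (δ : ℝ → M) (p q : M) : Prop extends IsGeodesic δ where
  norm_le : ‖deriv δ 0‖ ≤ Real.pi / 2
  zero : δ 0 = p
  one : δ 1 = q

/-- A normal neighbourhood of the projection `p` for `d_ρ`: a set of projections which contains a
`d_ρ`-ball around `p` and each point of which is joined to `p` by exactly one normalized
geodesic. -/
structure IsNormalNeighbourhood (τ : M →ₗ[ℂ] ℂ) (ρ : ℝ) (p : M) (U : Set M) : Prop where
  proj : ∀ q ∈ U, IsStarProjection q
  ball : ∃ ε : ℝ, 0 < ε ∧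
    ∀ q, IsStarProjection q → rhoDist τ ρ p q < ENNReal.ofReal ε → q ∈ U
  unique : ∀ q ∈ U, ∃! δ : ℝ → M, IsNormalizedGeodesicJoining δ p q

end Geometry

end ProjGeom

end

noncomputable section

/-! Let `p ≠ 0, 1`, and let `v ≠ 0` be a partial isometry with `v⋆v ≤ p` and `vv⋆ ≤ 1 - p`. Put `q =
p - v⋆v + vv⋆`. On the corner of `v⋆v + vv⋆`, rotating the symmetry `v⋆v - vv⋆` through `v + v⋆` to
its negative gives a geodesic from `p` to `q` of operator speed `π/2`. Replacing `v` by `zv` with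
`|z| = 1` leaves `q` fixed but moves the midpoint, so infinitely many normalized geodesics join `p`
to `q` (`infinite_setOf_joining`). Their `ρ`-length is `(π/2)(2τ(v⋆v))^(1/ρ)`, and `v` can be cut
down to subprojections of `v⋆v` of arbitrarily small trace, since no projection is minimal
(`exists_subprojection_trace_le`). So such `q` lie in every `d_ρ`-ball around `p`. Such a `v` exists
because in a factor the corner `(1-p)Ap` is nonzero (`exists_corner_ne_zero`), and a nonzero element
of it has a polar part there (`exists_isOffDiagonalPartialIsometry`). -/

namespace ProjGeom


/-! ### Rotation geodesics and their length -/

section Rotation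

variable {M : Type*} [CStarAlgebra M]

/-- A projection `a` together with two anticommuting symmetries `u`, `w` of a common
projection `u * u` orthogonal to `a`. -/
structure IsSymmetryPair (a u w : M) : Prop where
  proj : IsStarProjection a
  selfAdjoint_left : star u = u
  selfAdjoint_right : star w = w
  cube_left : u * (u * u) = u
  cube_right : w * (w * w) = w
  sq_right : w * w = u * u
  left_mul_right : u * w = -(w * u)
  proj_mul_left : a * u = 0
  proj_mul_right : a * w = 0

/-- The great circle through `u` and `w`, with half period one. -/
def greatCircle (u w : M) (t : ℝ) : M := Real.cos (Real.pi * t) • u + Real.sin (Real.pi * t) • w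

/-- The curve of projections obtained by rotating the symmetry `u` into `w`. -/
def rotationCurve (a u w : M) (t : ℝ) : M := a + (1 / 2 : ℝ) • (u * u + greatCircle u w t)

theorem hasDerivAt_greatCircle (u w : M) (t : ℝ) :
    HasDerivAt (greatCircle u w) (Real.pi • greatCircle w (-u) t) t := by
  have h : HasDerivAt (fun s : ℝ => Real.pi * s) Real.pi t := by
    simpa using (hasDerivAt_id t).const_mul Real.pi
  have := (h.cos.smul_const u).add (h.sin.smul_const w)
  convert! this using 1
  simp only [greatCircle]
  module

theorem contDiff_greatCircle (u w : M) : ContDiff ℝ ∞ (greatCircle u w) := by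
  unfold greatCircle
  fun_prop

theorem contDiff_rotationCurve (a u w : M) : ContDiff ℝ ∞ (rotationCurve a u w) :=
  contDiff_const.add ((contDiff_const.add (contDiff_greatCircle u w)).const_smul _)

theorem hasDerivAt_rotationCurve (a u w : M) (t : ℝ) :
    HasDerivAt (rotationCurve a u w) ((Real.pi / 2) • greatCircle w (-u) t) t := by
  convert! (((hasDerivAt_greatCircle u w t).const_add (u * u)).const_smul (1 / 2 : ℝ)).const_add a
    using 1
  module

theorem deriv_rotationCurve (a u w : M) :
    deriv (rotationCurve a u w) = fun t => (Real.pi / 2) • greatCircle w (-u) t :=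
  funext fun t => (hasDerivAt_rotationCurve a u w t).deriv

theorem deriv_deriv_rotationCurve (a u w : M) (t : ℝ) :
    deriv (deriv (rotationCurve a u w)) t = -(Real.pi ^ 2 / 2) • greatCircle u w t := by
  have h := (hasDerivAt_greatCircle w (-u) t).const_smul (Real.pi / 2)
  rw [deriv_rotationCurve]
  refine h.deriv.trans ?_
  simp only [greatCircle]
  module

theorem rotationCurve_zero (a u w : M) :
    rotationCurve a u w 0 = a + (1 / 2 : ℝ) • (u * u + u) := by
  simp [rotationCurve, greatCircle]

theorem rotationCurve_one (a u w : M) :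
    rotationCurve a u w 1 = a + (1 / 2 : ℝ) • (u * u - u) := by
  simp [rotationCurve, greatCircle, sub_eq_add_neg]

theorem codiag_eq_zero_of_commute {p x : M} (hp : IsIdempotentElem p) (h : Commute p x) :
    codiag p x = 0 := by
  have h1 : p * x * (1 - p) = 0 := by
    rw [h.eq, mul_assoc, mul_sub, mul_one, hp.eq, sub_self, mul_zero]
  have h2 : (1 - p) * x * p = 0 := by
    rw [mul_assoc, ← h.eq, ← mul_assoc, sub_mul, one_mul, hp.eq, sub_self, zero_mul]
  rw [codiag, h1, h2, add_zero]

/-- Functional calculus of a nonnegative multiple of a projection. -/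
theorem cfc_smul_of_isStarProjection {f : ℝ → ℝ} (hf : f 0 = 0) {c : ℝ} (hc : c ≠ 0) {e : M}
    (he : IsStarProjection e) : cfc f (c • e) = f c • e := by
  have hsa : IsSelfAdjoint e := he.isSelfAdjoint
  have hsa' : IsSelfAdjoint (c • e) := (IsSelfAdjoint.all c).smul hsa
  have hs : spectrum ℝ (c • e) ⊆ {0, c} := by
    intro x hx
    rw [← Units.val_mk0 hc, ← Units.smul_def, spectrum.unit_smul_eq_smul] at hx
    obtain ⟨y, hy, rfl⟩ := hx
    rcases he.isIdempotentElem.spectrum_subset ℝ hy with rfl | rfl <;> simp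
  -- On the spectrum, contained in `{0, c}`, `f` agrees with a linear function.
  calc cfc f (c • e) = cfc (fun t : ℝ => (f c / c) * t) (c • e) := by
        refine cfc_congr fun x hx => ?_
        rcases hs hx with rfl | rfl
        · simp [hf]
        · simp [hc]
    _ = (f c / c) • (c • e) := cfc_const_mul_id _ _
    _ = f c • e := by rw [smul_smul, div_mul_cancel₀ _ hc]

namespace IsSymmetryPair

variable {a u w : M}

theorem left_mul_proj (h : IsSymmetryPair a u w) : u * a = 0 := by
  simpa [h.selfAdjoint_left, h.proj.isSelfAdjoint.star_eq] using congr(star $(h.proj_mul_left))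

theorem right_mul_proj (h : IsSymmetryPair a u w) : w * a = 0 := by
  simpa [h.selfAdjoint_right, h.proj.isSelfAdjoint.star_eq] using congr(star $(h.proj_mul_right))

theorem isStarProjection_sq (h : IsSymmetryPair a u w) : IsStarProjection (u * u) where
  isIdempotentElem := by rw [IsIdempotentElem, mul_assoc, h.cube_left]
  isSelfAdjoint := by rw [IsSelfAdjoint, star_mul, h.selfAdjoint_left]

/-- The velocity runs along the great circle of the pair `w`, `-u`, so every identity for great
circles also applies to velocities. -/
theorem rotate (h : IsSymmetryPair a u w) : IsSymmetryPair a w (-u) where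
  proj := h.proj
  selfAdjoint_left := h.selfAdjoint_right
  selfAdjoint_right := by rw [star_neg, h.selfAdjoint_left]
  cube_left := h.cube_right
  cube_right := by rw [neg_mul_neg, neg_mul, h.cube_left]
  sq_right := by rw [neg_mul_neg, h.sq_right]
  left_mul_right := by rw [mul_neg, neg_mul, h.left_mul_right, neg_neg]
  proj_mul_left := h.proj_mul_right
  proj_mul_right := by rw [mul_neg, h.proj_mul_left, neg_zero]

theorem greatCircle_mul_self (h : IsSymmetryPair a u w) (t : ℝ) :
    greatCircle u w t * greatCircle u w t = u * u := by
  have hcs := Real.cos_sq_add_sin_sq (Real.pi * t)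
  simp only [greatCircle, add_mul, mul_add, smul_mul_assoc, mul_smul_comm, h.sq_right,
    h.left_mul_right]
  generalize Real.cos (Real.pi * t) = c at hcs ⊢
  generalize Real.sin (Real.pi * t) = s at hcs ⊢
  calc _ = (c ^ 2 + s ^ 2) • (u * u) := by module
    _ = u * u := by rw [hcs, one_smul]

theorem star_greatCircle (h : IsSymmetryPair a u w) (t : ℝ) :
    star (greatCircle u w t) = greatCircle u w t := by
  simp [greatCircle, h.selfAdjoint_left, h.selfAdjoint_right]

theorem sq_mul_greatCircle (h : IsSymmetryPair a u w) (t : ℝ) :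
    u * u * greatCircle u w t = greatCircle u w t := by
  simp only [greatCircle, mul_add, mul_smul_comm]
  rw [mul_assoc, h.cube_left, ← h.sq_right, mul_assoc, h.cube_right]

theorem greatCircle_mul_sq (h : IsSymmetryPair a u w) (t : ℝ) :
    greatCircle u w t * (u * u) = greatCircle u w t := by
  rw [← h.greatCircle_mul_self t, ← mul_assoc, h.greatCircle_mul_self, h.sq_mul_greatCircle]

theorem proj_mul_greatCircle (h : IsSymmetryPair a u w) (t : ℝ) : a * greatCircle u w t = 0 := by
  simp [greatCircle, mul_add, h.proj_mul_left, h.proj_mul_right]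

theorem greatCircle_mul_proj (h : IsSymmetryPair a u w) (t : ℝ) : greatCircle u w t * a = 0 := by
  simp [greatCircle, add_mul, h.left_mul_proj, h.right_mul_proj]

theorem isStarProjection_half_add (h : IsSymmetryPair a u w) (t : ℝ) :
    IsStarProjection ((1 / 2 : ℝ) • (u * u + greatCircle u w t)) where
  isIdempotentElem := by
    rw [IsIdempotentElem, smul_mul_smul_comm, mul_add, add_mul, add_mul,
      h.isStarProjection_sq.isIdempotentElem.eq, h.greatCircle_mul_sq, h.sq_mul_greatCircle,
      h.greatCircle_mul_self]
    module
  isSelfAdjoint := by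
    rw [IsSelfAdjoint, star_smul, star_add, h.star_greatCircle,
      h.isStarProjection_sq.isSelfAdjoint.star_eq]
    simp

theorem isStarProjection_rotationCurve (h : IsSymmetryPair a u w) (t : ℝ) :
    IsStarProjection (rotationCurve a u w t) :=
  h.proj.add (h.isStarProjection_half_add t) (by
    rw [mul_smul_comm, mul_add, ← mul_assoc, h.proj_mul_left, zero_mul, h.proj_mul_greatCircle,
      add_zero, smul_zero])

/-- The acceleration is a multiple of the great circle itself, which commutes with the projection on
the curve. -/
theorem isGeodesic_rotationCurve (h : IsSymmetryPair a u w) :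
    IsGeodesic (rotationCurve a u w) where
  smooth := contDiff_rotationCurve a u w
  proj := h.isStarProjection_rotationCurve
  parallel t := by
    rw [deriv_deriv_rotationCurve]
    refine codiag_eq_zero_of_commute (h.isStarProjection_rotationCurve t).isIdempotentElem
      (Commute.smul_right ?_ _)
    refine Commute.add_left ?_ (Commute.smul_left (Commute.add_left ?_ (Commute.refl _)) _)
    · rw [Commute, SemiconjBy, h.proj_mul_greatCircle, h.greatCircle_mul_proj]
    · rw [Commute, SemiconjBy, h.sq_mul_greatCircle, h.greatCircle_mul_sq]

/-- A constant multiple of a fixed projection: this controls both the operator norm and the `ρ`-norm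
of the velocity. -/
theorem star_velocity_mul_velocity (h : IsSymmetryPair a u w) (t : ℝ) :
    star ((Real.pi / 2) • greatCircle w (-u) t) * ((Real.pi / 2) • greatCircle w (-u) t)
      = (Real.pi / 2) ^ 2 • (u * u) := by
  rw [star_smul, h.rotate.star_greatCircle, smul_mul_smul_comm, h.rotate.greatCircle_mul_self,
    h.sq_right, star_trivial, sq]

theorem norm_deriv_rotationCurve_le (h : IsSymmetryPair a u w) (t : ℝ) :
    ‖deriv (rotationCurve a u w) t‖ ≤ Real.pi / 2 := by
  have hpi : 0 ≤ Real.pi / 2 := by positivity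
  refine abs_le_of_sq_le_sq' ?_ hpi |>.2
  rw [deriv_rotationCurve, sq, ← CStarRing.norm_star_mul_self, h.star_velocity_mul_velocity,
    norm_smul, norm_pow, Real.norm_of_nonneg hpi]
  exact mul_le_of_le_one_right (by positivity) (h.isStarProjection_sq.norm_le)

theorem isNormalizedGeodesicJoining (h : IsSymmetryPair a u w) :
    IsNormalizedGeodesicJoining (rotationCurve a u w)
      (a + (1 / 2 : ℝ) • (u * u + u)) (a + (1 / 2 : ℝ) • (u * u - u)) where
  toIsGeodesic := h.isGeodesic_rotationCurve
  norm_le := h.norm_deriv_rotationCurve_le 0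
  zero := rotationCurve_zero a u w
  one := rotationCurve_one a u w

theorem rhoDist_le (h : IsSymmetryPair a u w) (τ : M →ₗ[ℂ] ℂ) {ρ : ℝ} (hρ : 2 ≤ ρ)
    (hτ : 0 ≤ (τ (u * u)).re) :
    rhoDist τ ρ (a + (1 / 2 : ℝ) • (u * u + u)) (a + (1 / 2 : ℝ) • (u * u - u))
      ≤ ENNReal.ofReal (Real.pi / 2 * (τ (u * u)).re ^ (1 / ρ)) := by
  have hpi : 0 ≤ Real.pi / 2 := by positivity
  have hjoin : IsSmoothCurveJoining (rotationCurve a u w) 0 1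
      (a + (1 / 2 : ℝ) • (u * u + u)) (a + (1 / 2 : ℝ) • (u * u - u)) :=
    { lt := zero_lt_one
      smooth := (contDiff_rotationCurve a u w).contDiffOn
      proj := fun t _ => h.isStarProjection_rotationCurve t
      left := rotationCurve_zero a u w
      right := rotationCurve_one a u w }
  refine (iInf₂_le_of_le (rotationCurve a u w) 0 (iInf₂_le 1 hjoin)).trans_eq ?_
  have hspeed : ∀ t ∈ Set.Icc (0 : ℝ) 1, ENNReal.ofReal
      (rhoNorm τ ρ (derivWithin (rotationCurve a u w) (Set.Icc 0 1) t))
      = ENNReal.ofReal (Real.pi / 2 * (τ (u * u)).re ^ (1 / ρ)) := by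
    intro t ht
    rw [(hasDerivAt_rotationCurve a u w t).hasDerivWithinAt.derivWithin
      (uniqueDiffOn_Icc zero_lt_one t ht), rhoNorm, h.star_velocity_mul_velocity,
      cfc_smul_of_isStarProjection (f := fun t => t ^ (ρ / 2)) (Real.zero_rpow (by positivity))
        (pow_ne_zero 2 (by positivity)) h.isStarProjection_sq]
    have hre : ∀ (c : ℝ) (x : M), (τ (c • x)).re = c * (τ x).re := fun c x => by
      rw [← Complex.coe_smul, map_smul, smul_eq_mul, Complex.re_ofReal_mul]
    rw [hre, Real.mul_rpow (by positivity) hτ, ← Real.rpow_natCast, ← Real.rpow_mul hpi,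
      ← Real.rpow_mul hpi]
    congr 3
    have : ρ ≠ 0 := by positivity
    convert Real.rpow_one (Real.pi / 2)
    push_cast
    field_simp
  rw [rhoLength, MeasureTheory.setLIntegral_congr_fun measurableSet_Icc hspeed]
  simp

end IsSymmetryPair

end Rotation


/-! ### Geodesics from an off-diagonal partial isometry -/

section PartialIsometry

variable {M : Type*} [CStarAlgebra M]

/-- `v` is a partial isometry from a subprojection of `p` to a subprojection of `1 - p`. -/
structure IsOffDiagonalPartialIsometry (p v : M) : Prop where
  proj : IsStarProjection p
  mul_proj : v * p = v
  proj_mul : p * v = 0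
  mul_star_mul : v * (star v * v) = v

namespace IsOffDiagonalPartialIsometry

variable {p v : M}

theorem mul_self (h : IsOffDiagonalPartialIsometry p v) : v * v = 0 := by
  rw [← h.mul_proj, mul_assoc, ← mul_assoc p, h.proj_mul, zero_mul, mul_zero]

theorem smul (h : IsOffDiagonalPartialIsometry p v) (z : Circle) :
    IsOffDiagonalPartialIsometry p ((z : ℂ) • v) where
  proj := h.proj
  mul_proj := by rw [smul_mul_assoc, h.mul_proj]
  proj_mul := by rw [mul_smul_comm, h.proj_mul, smul_zero]
  mul_star_mul := by
    have hz : (starRingEnd ℂ) (z : ℂ) * z = 1 := by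
      rw [← Complex.normSq_eq_conj_mul_self, Circle.normSq_coe, Complex.ofReal_one]
    rw [star_smul, smul_mul_smul_comm, smul_mul_smul_comm, h.mul_star_mul, Complex.star_def, hz,
      mul_one]

/-- In the 2×2 matrix units generated by `v`, the pair is `diag(1, -1)` and the flip. -/
theorem isSymmetryPair (h : IsOffDiagonalPartialIsometry p v) :
    IsSymmetryPair (p - star v * v) (star v * v - v * star v) (v + star v) ∧
    (star v * v - v * star v) * (star v * v - v * star v) = star v * v + v * star v := by
  have hp := h.proj.isSelfAdjoint.star_eq
  have hpp : p * p = p := h.proj.isIdempotentElem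
  have h1 := h.mul_proj
  have h2 := h.proj_mul
  have h3 := h.mul_star_mul
  have h4 := h.mul_self
  have k1 : p * star v = star v := by simpa [hp] using congr(star $h1)
  have k2 : star v * p = 0 := by simpa [hp] using congr(star $h2)
  have k3 : star v * (v * star v) = star v := by simpa [mul_assoc] using congr(star $h3)
  have k4 : star v * star v = 0 := by simpa using congr(star $h4)
  have r3 : ∀ x, v * (star v * (v * x)) = v * x := fun x => by
    rw [← mul_assoc (star v), ← mul_assoc, h3]
  have l3 : ∀ x, star v * (v * (star v * x)) = star v * x := fun x => by
    rw [← mul_assoc v, ← mul_assoc, k3]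
  have r4 : ∀ x, v * (v * x) = 0 := fun x => by rw [← mul_assoc, h4, zero_mul]
  have l4 : ∀ x, star v * (star v * x) = 0 := fun x => by rw [← mul_assoc, k4, zero_mul]
  have r2 : ∀ x, p * (v * x) = 0 := fun x => by rw [← mul_assoc, h2, zero_mul]
  have l1 : ∀ x, p * (star v * x) = star v * x := fun x => by rw [← mul_assoc, k1]
  refine ⟨⟨⟨?_, ?_⟩, ?_, ?_, ?_, ?_, ?_, ?_, ?_, ?_⟩, ?_⟩ <;>
  simp only [IsIdempotentElem, IsSelfAdjoint, star_sub, star_add, star_mul, star_star, hp, mul_add,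
    add_mul, mul_sub, sub_mul, mul_neg, mul_assoc, hpp, h1, h2, h3, h4, k1, k3, k4, r4, l4, r2,
    l1, sub_zero, zero_sub, mul_zero, add_zero, zero_add] <;> abel

/-- The other endpoint of the rotation curves defined by `v`. -/
def endpoint (p v : M) : M := p - star v * v + v * star v

/-- The phase cancels, so `endpoint` does not see it. -/
theorem star_mul_self_smul (z : Circle) (v : M) :
    star ((z : ℂ) • v) * ((z : ℂ) • v) = star v * v ∧
      ((z : ℂ) • v) * star ((z : ℂ) • v) = v * star v := by
  have hz : (starRingEnd ℂ) (z : ℂ) * z = 1 := by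
    rw [← Complex.normSq_eq_conj_mul_self, Circle.normSq_coe, Complex.ofReal_one]
  constructor
  · rw [star_smul, smul_mul_smul_comm, Complex.star_def, hz, one_smul]
  · rw [star_smul, smul_mul_smul_comm, Complex.star_def, mul_comm, hz, one_smul]

/-- The rotation curve defined by the partial isometry `v`. -/
def curve (p v : M) : ℝ → M :=
  rotationCurve (p - star v * v) (star v * v - v * star v) (v + star v)

theorem left_endpoint (h : IsOffDiagonalPartialIsometry p v) :
    p - star v * v + (1 / 2 : ℝ) • ((star v * v - v * star v) * (star v * v - v * star v) +
      (star v * v - v * star v)) = p := by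
  rw [h.isSymmetryPair.2]
  module

theorem right_endpoint (h : IsOffDiagonalPartialIsometry p v) :
    p - star v * v + (1 / 2 : ℝ) • ((star v * v - v * star v) * (star v * v - v * star v) -
      (star v * v - v * star v)) = endpoint p v := by
  rw [h.isSymmetryPair.2, endpoint]
  module

theorem curve_joins (h : IsOffDiagonalPartialIsometry p v) :
    IsNormalizedGeodesicJoining (curve p v) p (endpoint p v) := by
  have := h.isSymmetryPair.1.isNormalizedGeodesicJoining
  rwa [h.left_endpoint, h.right_endpoint] at this

theorem isStarProjection_endpoint (h : IsOffDiagonalPartialIsometry p v) :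
    IsStarProjection (endpoint p v) := by
  rw [← h.curve_joins.one]
  exact h.curve_joins.proj 1

/-- Equality would make `v` normal, but `v * v = 0`. -/
theorem endpoint_ne (h : IsOffDiagonalPartialIsometry p v) (hv : v ≠ 0) : endpoint p v ≠ p := by
  intro he
  have h0 : v * star v = star v * v := by
    have : endpoint p v - p = v * star v - star v * v := by rw [endpoint]; abel
    rw [he, sub_self] at this
    exact (sub_eq_zero.1 this.symm)
  apply hv
  rw [← h.mul_star_mul, ← h0, ← mul_assoc, h.mul_self, zero_mul]

theorem infinite_setOf_joining (h : IsOffDiagonalPartialIsometry p v) (hv : v ≠ 0) :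
    {δ : ℝ → M | IsNormalizedGeodesicJoining δ p (endpoint p v)}.Infinite := by
  have hmem : ∀ z : Circle, IsNormalizedGeodesicJoining (curve p ((z : ℂ) • v)) p (endpoint p v) := by
    intro z
    have := (h.smul z).curve_joins
    rwa [endpoint, (star_mul_self_smul z v).1, (star_mul_self_smul z v).2] at this
  have hinj : Function.Injective fun z : Circle => curve p ((z : ℂ) • v) := by
    intro z z' hz
    -- The midpoint contains `z • v` plus its adjoint; multiplying by `p` on the right isolates `z •
    -- v`.
    have hz := congr_fun hz (1 / 2)
    have hs : Real.sin (Real.pi * (1 / 2)) = 1 := by rw [mul_one_div, Real.sin_pi_div_two]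
    simp only [curve, rotationCurve, greatCircle, (star_mul_self_smul _ v).1,
      (star_mul_self_smul _ v).2, hs, one_smul] at hz
    have hz' := smul_right_injective M (by norm_num : (1 / 2 : ℝ) ≠ 0) (add_left_cancel hz)
    have hz' := congr($(add_left_cancel (add_left_cancel hz')) * p)
    have k2 : star v * p = 0 := by
      simpa [h.proj.isSelfAdjoint.star_eq] using congr(star $(h.proj_mul))
    simp only [add_mul, star_smul, smul_mul_assoc, k2, smul_zero, add_zero, h.mul_proj] at hz'
    exact Subtype.ext (smul_left_injective ℂ hv hz')
  have : Infinite Circle := by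
    have : (Set.Ioc (-Real.pi) Real.pi).Infinite := Set.Ioc_infinite (by linarith [Real.pi_pos])
    have := this.to_subtype
    exact Infinite.of_injective (fun θ : Set.Ioc (-Real.pi) Real.pi => Circle.exp θ)
      fun x y hxy => Subtype.ext (Circle.exp_injOn_Ioc (by linarith) x.2 y.2 hxy)
  exact (Set.infinite_range_of_injective hinj).mono (Set.range_subset_iff.2 hmem)

theorem rhoDist_endpoint_le (h : IsOffDiagonalPartialIsometry p v) {τ : M →ₗ[ℂ] ℂ}
    (hτ : IsTracialState τ) {ρ : ℝ} (hρ : 2 ≤ ρ) : rhoDist τ ρ p (endpoint p v)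
      ≤ ENNReal.ofReal (Real.pi / 2 * (2 * (τ (star v * v)).re) ^ (1 / ρ)) := by
  have ht : (τ ((star v * v - v * star v) * (star v * v - v * star v))).re
      = 2 * (τ (star v * v)).re := by
    rw [h.isSymmetryPair.2, map_add, hτ.tracial v, Complex.add_re]
    ring
  have := h.isSymmetryPair.1.rhoDist_le τ hρ (by
    rw [ht]
    exact mul_nonneg zero_le_two (hτ.nonneg_re v))
  rwa [h.left_endpoint, h.right_endpoint, ht] at this

/-- Restriction of the partial isometry to a smaller projection. -/
theorem restrict (h : IsOffDiagonalPartialIsometry p v) {e : M} (he : IsStarProjection e)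
    (hle : star v * v * e = e) :
    IsOffDiagonalPartialIsometry p (v * e) ∧ star (v * e) * (v * e) = e := by
  have hse : star (v * e) * (v * e) = e := by
    rw [star_mul, he.isSelfAdjoint.star_eq, mul_assoc, ← mul_assoc (star v), hle,
      he.isIdempotentElem.eq]
  have hpe : p * e = e := by
    have k1 : p * star v = star v := by
      simpa [h.proj.isSelfAdjoint.star_eq] using congr(star $(h.mul_proj))
    rw [← hle, ← mul_assoc, ← mul_assoc, k1]
  have hep : e * p = e := by
    simpa [h.proj.isSelfAdjoint.star_eq, he.isSelfAdjoint.star_eq] using congr(star $hpe)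
  refine ⟨⟨h.proj, by rw [mul_assoc, hep], by rw [← mul_assoc, h.proj_mul, zero_mul], ?_⟩, hse⟩
  rw [hse, mul_assoc, he.isIdempotentElem.eq]

end IsOffDiagonalPartialIsometry

end PartialIsometry


/-! ### Partial isometries and small projections in the factor -/

section Factor

variable {H : Type*} [NormedAddCommGroup H] [InnerProductSpace ℂ H] [CompleteSpace H]
  {A : VonNeumannAlgebra H}

/-- The range projection of an element of a von Neumann algebra belongs to the algebra. -/
theorem exists_range_projection (x : Elt A) : ∃ e : Elt A, IsStarProjection e ∧ e * x = x ∧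
    ∀ y : Elt A, y * x = 0 → y * e = 0 := by
  set K : Submodule ℂ H := (x : H →L[ℂ] H).range.topologicalClosure with hK
  have : CompleteSpace K := (Submodule.isClosed_topologicalClosure _).completeSpace_coe
  have hrange : K.starProjection.range = K := K.range_starProjection
  have hproj : IsStarProjection K.starProjection := isStarProjection_starProjection
  have hmem : K.starProjection ∈ A := by
    -- By the bicommutant criterion, it suffices that the commutant leaves the closed range
    -- invariant.
    rw [VonNeumannAlgebra.IsStarProjection.mem_iff hproj, hrange]
    intro y hy
    have hcomm := VonNeumannAlgebra.mem_commutant_iff.1 hy x x.2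
    rw [Module.End.mem_invtSubmodule]
    refine Submodule.topologicalClosure_minimal _ ?_
      ((Submodule.isClosed_topologicalClosure _).preimage y.continuous)
    rintro _ ⟨z, rfl⟩
    refine Submodule.le_topologicalClosure _ ⟨y z, ?_⟩
    exact congr($hcomm z)
  refine ⟨⟨K.starProjection, hmem⟩, ⟨Subtype.ext hproj.isIdempotentElem,
    Subtype.ext hproj.isSelfAdjoint⟩, Subtype.ext ?_, fun y hy => Subtype.ext ?_⟩
  · ext z
    exact Submodule.starProjection_eq_self_iff.2 (Submodule.le_topologicalClosure _ ⟨z, rfl⟩)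
  · have hker : K ≤ (y : H →L[ℂ] H).ker := by
      refine Submodule.topologicalClosure_minimal _ ?_ (y : H →L[ℂ] H).isClosed_ker
      rintro _ ⟨z, rfl⟩
      exact congr(($hy : H →L[ℂ] H) z)
    ext z
    exact hker (Submodule.starProjection_apply_mem K z)

/-- Continuous functions `f`, `k`, `g` such that `f` is supported in `[δ, ∞)`, where
`k t = t ^ (-1/2)`, and `f t = t * g t`. -/
theorem exists_cutoff_functions {δ : ℝ} (hδ : 0 < δ) : ∃ f k g : ℝ → ℝ,
    Continuous f ∧ Continuous k ∧ Continuous g ∧ (∀ t, f t = 0 → t ≤ δ) ∧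
    (∀ t, k t * t * k t * f t = f t) ∧ ∀ t, t * g t = f t := by
  have hmax : ∀ t : ℝ, 0 < max t δ := fun t => lt_max_of_lt_right hδ
  have hf : Continuous fun t : ℝ => max (t - δ) 0 := by fun_prop
  -- Replacing `t` by `max t δ` removes the singularity at `0` and changes nothing where `f ≠ 0`.
  refine ⟨fun t => max (t - δ) 0, fun t => (Real.sqrt (max t δ))⁻¹,
    fun t => max (t - δ) 0 / max t δ, hf,
    Continuous.inv₀ (by fun_prop) fun t => (Real.sqrt_pos.2 (hmax t)).ne',
    hf.div (by fun_prop) fun t => (hmax t).ne', fun t ht => ?_, fun t => ?_, fun t => ?_⟩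
  · have := le_max_left (t - δ) 0
    dsimp only at ht
    linarith
  · rcases le_total t δ with ht | ht
    · simp [ht]
    · have hs := Real.mul_self_sqrt (hδ.le.trans ht)
      have hs0 : Real.sqrt t ≠ 0 := (Real.sqrt_pos.2 (hδ.trans_le ht)).ne'
      have : (Real.sqrt t)⁻¹ * t * (Real.sqrt t)⁻¹ = 1 := by
        nth_rewrite 2 [← hs]
        field_simp
      simp only [max_eq_left ht, this, one_mul]
  · rcases le_total t δ with ht | ht
    · simp [ht]
    · have := (hδ.trans_le ht).ne'
      simp only [max_eq_left ht]
      field_simp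

/-- An approximate inverse square root of `star y * y` on a nonzero spectral subspace. -/
theorem exists_approx_inv_sqrt {M : Type*} [CStarAlgebra M] {y : M} (hy : y ≠ 0) :
    ∃ F K G : M, F ≠ 0 ∧ star K = K ∧ K * (star y * y) * K * F = F ∧ star y * y * G = F := by
  have hsa : IsSelfAdjoint (star y * y) := IsSelfAdjoint.star_mul_self y
  have hpos : ∀ t ∈ spectrum ℝ (star y * y), 0 ≤ t := spectrum_star_mul_self_nonneg
  have hh0 : star y * y ≠ 0 := (CStarRing.star_mul_self_ne_zero_iff y).2 hy
  generalize star y * y = h at *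
  have hδ : 0 < ‖h‖ / 2 := half_pos (norm_pos_iff.2 hh0)
  obtain ⟨f, k, g, hf, hk, hg, hf0, hkf, hgf⟩ := exists_cutoff_functions hδ
  have hid : Continuous fun t : ℝ => t := continuous_id
  refine ⟨cfc f h, cfc k h, cfc g h, fun h0 => ?_, (cfc_predicate k h : IsSelfAdjoint _), ?_, ?_⟩
  -- If `F = 0`, the spectrum lies below `‖h‖ / 2`, contradicting `h ≠ 0`.
  · have heq : Set.EqOn f (fun _ => 0) (spectrum ℝ h) := by
      refine (cfc_eq_cfc_iff_eqOn (a := h) hsa hf.continuousOn continuousOn_const).1 ?_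
      rw [h0, cfc_const_zero]
    have hle : ‖cfc (id : ℝ → ℝ) h‖ ≤ ‖h‖ / 2 := by
      refine norm_cfc_le hδ.le fun t ht => ?_
      rw [id, Real.norm_of_nonneg (hpos t ht)]
      exact hf0 t (heq ht)
    rw [cfc_id ℝ h] at hle
    linarith
  · calc cfc k h * h * cfc k h * cfc f h
        = cfc k h * cfc (fun t => t) h * cfc k h * cfc f h := by rw [cfc_id' ℝ h]
      _ = cfc (fun t => k t * t * k t * f t) h := by
        rw [cfc_mul (fun t => k t * t * k t) f h ((hk.mul hid).mul hk).continuousOn hf.continuousOn,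
          cfc_mul (fun t => k t * t) k h (hk.mul hid).continuousOn hk.continuousOn,
          cfc_mul k (fun t => t) h hk.continuousOn hid.continuousOn]
      _ = cfc f h := by simp_rw [hkf]
  · calc h * cfc g h = cfc (fun t => t) h * cfc g h := by rw [cfc_id' ℝ h]
      _ = cfc (fun t => t * g t) h := (cfc_mul _ _ h hid.continuousOn hg.continuousOn).symm
      _ = cfc f h := by simp_rw [hgf]

/-- A nonzero corner of a von Neumann algebra contains a nonzero partial isometry. -/
theorem exists_isOffDiagonalPartialIsometry {p y : Elt A} (hp : IsStarProjection p)
    (hyp : y * p = y) (hpy : p * y = 0) (hy : y ≠ 0) :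
    ∃ v : Elt A, IsOffDiagonalPartialIsometry p v ∧ v ≠ 0 := by
  obtain ⟨F, K, G, hF0, hK, hKF, hG⟩ := exists_approx_inv_sqrt hy
  obtain ⟨e, he, heF, hmin⟩ := exists_range_projection F
  -- Left identities of `F` pass to its range projection `e`.
  have hfix : ∀ x : Elt A, x * F = F → x * e = e := fun x hx => by
    have := hmin (x - 1) (by rw [sub_mul, one_mul, hx, sub_self])
    rwa [sub_mul, one_mul, sub_eq_zero] at this
  have hKe : K * (star y * y) * K * e = e := hfix _ hKF
  have hpe : p * e = e := hfix _ (by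
    have hpy' : p * star y = star y := by
      simpa [hp.isSelfAdjoint.star_eq] using congr(star $hyp)
    rw [← hG, ← mul_assoc, ← mul_assoc, hpy'])
  have hep : e * p = e := by
    simpa [hp.isSelfAdjoint.star_eq, he.isSelfAdjoint.star_eq] using congr(star $hpe)
  -- Since `K` acts as `(y⋆y)^(-1/2)` on `e`, `y * K * e` is the polar part of `y` cut down to `e`.
  have hvv : star (y * K * e) * (y * K * e) = e := by
    calc _ = e * (K * (star y * y) * K * e) := by
          simp only [star_mul, hK, he.isSelfAdjoint.star_eq, mul_assoc]
      _ = e := by rw [hKe, he.isIdempotentElem.eq]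
  refine ⟨y * K * e, ⟨hp, ?_, ?_, ?_⟩, fun h0 => hF0 ?_⟩
  · rw [mul_assoc, hep]
  · rw [← mul_assoc, ← mul_assoc, hpy, zero_mul, zero_mul]
  · rw [hvv, mul_assoc, he.isIdempotentElem.eq]
  · rw [h0, mul_zero] at hvv
    rw [← heF, ← hvv, zero_mul]

/-- If the corner vanishes, so does its adjoint; then `p` is central, hence an idempotent scalar. -/
theorem exists_corner_ne_zero (hA : IsFactor A) {p : Elt A} (hp : IsStarProjection p)
    (h0 : p ≠ 0) (h1 : p ≠ 1) : ∃ y : Elt A, y * p = y ∧ p * y = 0 ∧ y ≠ 0 := by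
  by_contra! hcon
  have hcorner : ∀ x : Elt A, x * p = p * x * p := by
    intro x
    have := hcon ((1 - p) * x * p) (by rw [mul_assoc, hp.isIdempotentElem.eq])
      (by rw [← mul_assoc, ← mul_assoc, hp.mul_one_sub_self, zero_mul, zero_mul])
    rwa [sub_mul, sub_mul, one_mul, sub_eq_zero] at this
  have hcomm : ∀ x : Elt A, p * x = x * p := by
    intro x
    have := congr(star $(hcorner (star x)))
    simp only [star_mul, star_star, hp.isSelfAdjoint.star_eq] at this
    rw [this, ← mul_assoc, ← hcorner]
  obtain ⟨c, hc⟩ := hA.center_trivial p hcomm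
  have hsq : (c * c) • (1 : Elt A) = c • 1 := by
    have := hp.isIdempotentElem.eq
    rwa [hc, smul_mul_smul_comm, one_mul] at this
  have hcc : c * c = c := smul_left_injective ℂ hA.one_ne_zero hsq
  by_cases hc0 : c = 0
  · exact h0 (by rw [hc, hc0, zero_smul])
  · exact h1 (by rw [hc, mul_left_cancel₀ hc0 (hcc.trans (mul_one c).symm), one_smul])

/-- Split `f` as `q + (f - q)` and keep the part of smaller trace: each step at least halves the
bound. -/
theorem exists_subprojection_trace_le (hA : IsTypeIIOneFactor A) (τ : Elt A →ₗ[ℂ] ℂ)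
    {e : Elt A} (he : IsStarProjection e) (h0 : e ≠ 0) (n : ℕ) :
    ∃ f : Elt A, IsStarProjection f ∧ e * f = f ∧ f ≠ 0 ∧
      (τ f).re ≤ (τ e).re / 2 ^ n := by
  induction n with
  | zero => exact ⟨e, he, he.isIdempotentElem, h0, by simp⟩
  | succ n ih =>
    obtain ⟨f, hf, hef, hf0, hfτ⟩ := ih
    obtain ⟨q, hq, hfq, hq0, hqf⟩ := hA.no_minimal f hf hf0
    have hd : IsStarProjection (f - q) := hq.sub_of_mul_eq_right hf hfq
    have hsum : (τ (f - q)).re + (τ q).re = (τ f).re := by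
      rw [← Complex.add_re, ← map_add, sub_add_cancel]
    have hpow : (τ e).re / 2 ^ (n + 1) = (τ e).re / 2 ^ n / 2 := by rw [pow_succ, div_div]
    rcases le_total (τ q).re (τ (f - q)).re with hle | hle
    · exact ⟨q, hq, by rw [← hfq, ← mul_assoc, hef], hq0, by rw [hpow]; linarith⟩
    · refine ⟨f - q, hd, ?_, sub_ne_zero.2 hqf.symm, by rw [hpow]; linarith⟩
      rw [mul_sub, hef, ← hfq, ← mul_assoc, hef]

open IsOffDiagonalPartialIsometry in
theorem exists_close_endpoint (hA : IsTypeIIOneFactor A) {τ : Elt A →ₗ[ℂ] ℂ}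
    (hτ : IsTracialState τ) {ρ : ℝ} (hρ : 2 ≤ ρ) {p : Elt A} (hp : IsStarProjection p)
    (h0 : p ≠ 0) (h1 : p ≠ 1) {ε : ℝ} (hε : 0 < ε) : ∃ q : Elt A, IsStarProjection q ∧ p ≠ q ∧
      rhoDist τ ρ p q < ENNReal.ofReal ε ∧
      {δ : ℝ → Elt A | IsNormalizedGeodesicJoining δ p q}.Infinite := by
  obtain ⟨y, hyp, hpy, hy⟩ := exists_corner_ne_zero hA.toIsFactor hp h0 h1
  obtain ⟨v, hv, hv0⟩ := exists_isOffDiagonalPartialIsometry hp hyp hpy hy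
  have he : IsStarProjection (star v * v) :=
    ⟨by rw [IsIdempotentElem, mul_assoc, hv.mul_star_mul], IsSelfAdjoint.star_mul_self v⟩
  have he0 : star v * v ≠ 0 := (CStarRing.star_mul_self_ne_zero_iff v).2 hv0
  -- The length bound after `n` halvings tends to zero, as `1 / ρ > 0`.
  have hlim : Filter.Tendsto
      (fun n : ℕ => Real.pi / 2 * (2 * ((τ (star v * v)).re / 2 ^ n)) ^ (1 / ρ))
      Filter.atTop (nhds 0) := by
    have hρ' : 0 < 1 / ρ := by positivity
    have h2 : Filter.Tendsto (fun n : ℕ => 2 * ((τ (star v * v)).re / 2 ^ n))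
        Filter.atTop (nhds 0) := by
      have := ((tendsto_pow_atTop_nhds_zero_of_lt_one (r := (1 / 2 : ℝ)) (by norm_num)
        (by norm_num)).const_mul (τ (star v * v)).re).const_mul 2
      simpa [div_eq_mul_inv] using this
    have := (h2.rpow_const (Or.inr hρ'.le)).const_mul (Real.pi / 2)
    rwa [Real.zero_rpow hρ'.ne', mul_zero] at this
  obtain ⟨n, hn⟩ := (hlim.eventually (gt_mem_nhds hε)).exists
  obtain ⟨f, hf, hef, hf0, hfτ⟩ := exists_subprojection_trace_le hA τ he he0 n
  obtain ⟨hw, hwf⟩ := hv.restrict hf hef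
  have hw0 : v * f ≠ 0 := fun h => hf0 (by rw [← hwf, h, mul_zero])
  refine ⟨endpoint p (v * f), hw.isStarProjection_endpoint, (hw.endpoint_ne hw0).symm,
    (hw.rhoDist_endpoint_le hτ hρ).trans_lt ?_, hw.infinite_setOf_joining hw0⟩
  rw [hwf, ENNReal.ofReal_lt_ofReal_iff hε]
  have hf' : 0 ≤ (τ f).re := by simpa only [hwf] using hτ.nonneg_re (v * f)
  refine lt_of_le_of_lt ?_ hn
  gcongr

end Factor

end ProjGeom

end

theorem mainTheorem3 {H : Type*} [NormedAddCommGroup H] [InnerProductSpace ℂ H] [CompleteSpace H]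
    (A : VonNeumannAlgebra H) (hA : ProjGeom.IsTypeIIOneFactor A)
    (τ : ProjGeom.Elt A →ₗ[ℂ] ℂ) (hτ : ProjGeom.IsTracialState τ)
    (ρ : ℝ) (hρ : 2 ≤ ρ) :
    (∀ ε : ℝ, 0 < ε → ∃ p q : ProjGeom.Elt A,
      IsStarProjection p ∧ IsStarProjection q ∧ p ≠ q ∧
      ProjGeom.rhoDist τ ρ p q < ENNReal.ofReal ε ∧
      {δ : ℝ → ProjGeom.Elt A | ProjGeom.IsNormalizedGeodesicJoining δ p q}.Infinite) ∧
    (∀ p : ProjGeom.Elt A, IsStarProjection p → p ≠ 0 → p ≠ 1 →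
      ¬ ∃ U : Set (ProjGeom.Elt A), ProjGeom.IsNormalNeighbourhood τ ρ p U) := by
  refine ⟨fun ε hε => ?_, fun p hp h0 h1 => ?_⟩
  -- A nontrivial projection exists because `1` is not minimal.
  · obtain ⟨p, hp, -, h0, h1⟩ := hA.no_minimal 1 (.one _) hA.one_ne_zero
    exact ⟨p, (ProjGeom.exists_close_endpoint hA hτ hρ hp h0 h1 hε).imp fun q h => ⟨hp, h⟩⟩
  · rintro ⟨U, hU⟩
    obtain ⟨ε, hε, hball⟩ := hU.ball
    obtain ⟨q, hq, -, hdist, hinf⟩ := ProjGeom.exists_close_endpoint hA hτ hρ hp h0 h1 hε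
    obtain ⟨δ, -, huniq⟩ := hU.unique q (hball q hq hdist)
    exact hinf ((Set.finite_singleton δ).subset fun δ' h' => huniq δ' h')
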